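/- Let $q$ be a prime power, let $V$ be a $3$-dimensional vector space over $\mathbb{F}_{q^4}$, and let $\mathrm{PG}(2,q^4)=\mathrm{PG}(V,\mathbb{F}_{q^4})$. For an $\mathbb{F}_q$-subspace $U$ of $V$ with $\dim_{\mathbb{F}_q}U=5$, let $L_U=\{\langle u\rangle_{\mathbb{F}_{q^4}} : u\in U\setminus\{0\}\}$ be the associated $\mathbb{F}_q$-linear set of rank $5$ in $\mathrm{PG}(2,q^4)$. Then $L_U$ is $1$-saturating, that is, every point of $\mathrm{PG}(2,q^4)$ lies on a line joining two distinct points of $L_U$, if and only if $L_U$ is not (the point set of) a line of $\mathrm{PG}(2,q^4)$. -/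

import Mathlib

open scoped LinearAlgebra.Projectivization

section LinearSets

variable (F K : Type*) {V : Type*} [Field F] [Field K] [Algebra F K]
  [AddCommGroup V] [Module K V] [Module F V] [IsScalarTower F K V]

/-- The `F`-linear set `L_U` in `PG(V, K)` defined by an `F`-subspace `U` of the `K`-vector space
`V`: the set of all points `⟨u⟩_K` with `u` a nonzero vector of `U`. -/
def linearSet (U : Submodule F V) : Set (ℙ K V) :=
  {P | ∃ (u : V) (hu : u ≠ 0), u ∈ U ∧ P = Projectivization.mk K u hu}

end LinearSets

section PointSets

variable {K V : Type*} [Field K] [AddCommGroup V] [Module K V]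

/-- A set `S` of points of `PG(V, K)` is `ρ`-saturating if every point of `PG(V, K)` belongs to a
projective subspace of (projective) dimension `ρ` spanned by `ρ + 1` points of `S`. The span of
`ρ + 1` points has projective dimension `ρ` exactly when they are projectively independent. -/
def IsSaturating (ρ : ℕ) (S : Set (ℙ K V)) : Prop :=
  ∀ P : ℙ K V, ∃ Q : Fin (ρ + 1) → ℙ K V, (∀ i, Q i ∈ S) ∧
    Projectivization.Independent Q ∧ P ∈ Projectivization.Subspace.span (Set.range Q)

/-- A set `S` of points of `PG(V, K)` is a line if it is the full point set of a projective
subspace of projective dimension `1`, i.e. of vector-space dimension `2`. -/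
def IsProjLine (S : Set (ℙ K V)) : Prop :=
  ∃ ℓ : Projectivization.Subspace K V,
    Module.finrank K (Projectivization.Subspace.submodule ℓ) = 2 ∧ S = (ℓ : Set (ℙ K V))

end PointSets

/-! A line is a proper subspace, so the secants of its points stay inside it and it is not
saturating. Conversely, write B for the linear set. Since 5 > 4, B meets every line, so projection
from any point outside B maps B onto a projective line. If some P outside B lies on no secant, its
projection is also injective, so B has exactly as many points as a line. By finiteness the
projection from every other point outside B is then injective too, so no such point lies on a secant
(`IsBlocking.exists_subspace`). Hence B is a subspace, and dimensions make it a line. -/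

section BlockingSets

open Projectivization

variable {K V : Type*} [Field K] [AddCommGroup V] [Module K V]

/-- Projection of a three-dimensional space from a nonzero vector. -/
lemma exists_ker_eq_span_singleton (hV : Module.finrank K V = 3) {t : V} (ht : t ≠ 0) :
    ∃ π : V →ₗ[K] (Fin 2 → K), LinearMap.ker π = Submodule.span K {t} := by
  have : FiniteDimensional K V := Module.finite_of_finrank_pos (by omega)
  have h1 := Submodule.finrank_quotient_add_finrank (Submodule.span K {t})
  rw [finrank_span_singleton ht, hV] at h1
  have e : (V ⧸ Submodule.span K {t}) ≃ₗ[K] (Fin 2 → K) :=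
    LinearEquiv.ofFinrankEq _ _ (by rw [Module.finrank_fin_fun]; omega)
  exact ⟨e.toLinearMap ∘ₗ (Submodule.span K {t}).mkQ, by
    rw [LinearEquiv.ker_comp, Submodule.ker_mkQ]⟩

/-- A set of points of `PG(V, K)` blocks the kernel of every linear functional. -/
def IsBlocking (B : Set (ℙ K V)) : Prop :=
  ∀ ψ : V →ₗ[K] K, ∃ (v : V) (hv : v ≠ 0), ψ v = 0 ∧ mk K v hv ∈ B

/-- Projecting a blocking set of a plane from a point outside it gives a surjection onto the
projective line; two points have the same image exactly when they are collinear with the centre. -/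
lemma IsBlocking.exists_surjective_projection (hV : Module.finrank K V = 3) {B : Set (ℙ K V)}
    (hB : IsBlocking B) {T : ℙ K V} (hT : T ∉ B) :
    ∃ φ : B → ℙ K (Fin 2 → K), Function.Surjective φ ∧
      (∀ b b' : B, φ b = φ b' → b ≠ b' → T ∈ Subspace.span {b.1, b'.1}) ∧
      (∀ (x y : V) (hx : x ≠ 0) (hy : y ≠ 0) (hxy : x + y ≠ 0) (hxB : mk K x hx ∈ B)
        (hyB : mk K y hy ∈ B), mk K (x + y) hxy = T →
        φ ⟨mk K x hx, hxB⟩ = φ ⟨mk K y hy, hyB⟩) := by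
  induction T using Projectivization.ind with | h t ht => ?_
  obtain ⟨π, hπ⟩ := exists_ker_eq_span_singleton hV ht
  have hker : ∀ v, π v = 0 ↔ ∃ c : K, c • t = v := fun v => by
    rw [← LinearMap.mem_ker, hπ, Submodule.mem_span_singleton]
  have hne : ∀ (v : V) (hv : v ≠ 0), mk K v hv ∈ B → π v ≠ 0 := by
    intro v hv hvB h0
    exact hT ((mk_eq_mk_iff' K v t hv ht).2 ((hker v).1 h0) ▸ hvB)
  have hne' : ∀ b : B, π b.1.rep ≠ 0 := fun b =>
    hne _ (rep_nonzero _) (by rw [mk_rep]; exact b.2)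
  let φ : B → ℙ K (Fin 2 → K) := fun b => mk K (π b.1.rep) (hne' b)
  have hφ : ∀ (v : V) (hv : v ≠ 0) (hvB : mk K v hv ∈ B),
      φ ⟨mk K v hv, hvB⟩ = mk K (π v) (hne v hv hvB) := by
    intro v hv hvB
    obtain ⟨a, ha⟩ := exists_smul_eq_mk_rep K v hv
    refine (mk_eq_mk_iff K _ _ _ _).2 ⟨a, ?_⟩
    rw [← ha, Units.smul_def, Units.smul_def, map_smul]
  refine ⟨φ, fun p => ?_, ?_, ?_⟩
  · induction p using Projectivization.ind with | h w hw => ?_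
    -- The kernel of ψ is spanned by w, so a point of B killed by ψ ∘ π projects to the point of w.
    let ψ : (Fin 2 → K) →ₗ[K] K :=
      w 1 • LinearMap.proj (0 : Fin 2) - w 0 • LinearMap.proj (1 : Fin 2)
    obtain ⟨v, hv, hψ, hvB⟩ := hB (ψ ∘ₗ π)
    refine ⟨⟨mk K v hv, hvB⟩, ?_⟩
    rw [hφ, mk_eq_mk_iff']
    have h : w 1 * π v 0 - w 0 * π v 1 = 0 := by simpa [ψ] using hψ
    by_cases h0 : w 0 = 0
    · have h1 : w 1 ≠ 0 := fun h1 => hw (by ext i; fin_cases i <;> simp [h0, h1])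
      refine ⟨π v 1 / w 1, ?_⟩
      ext i
      fin_cases i
      · have : π v 0 = 0 := by simpa [h0, h1] using h
        simp [h0, this]
      · simp [h1]
    · refine ⟨π v 0 / w 0, ?_⟩
      ext i
      fin_cases i
      · simp [h0]
      · simp only [Pi.smul_apply, smul_eq_mul, Fin.mk_one]
        field_simp
        linear_combination h
  · intro b b' hbb hn
    obtain ⟨a, ha⟩ := (mk_eq_mk_iff' K _ _ _ _).1 hbb
    obtain ⟨c, hc⟩ := (hker (b.1.rep - a • b'.1.rep)).1 (by rw [map_sub, map_smul, ha, sub_self])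
    have hc0 : c ≠ 0 := by
      rintro rfl
      rw [zero_smul] at hc
      apply hn
      apply Subtype.ext
      rw [← mk_rep b.1, ← mk_rep b'.1, mk_eq_mk_iff']
      exact ⟨a, (sub_eq_zero.1 hc.symm).symm⟩
    rw [Subspace.mem_span]
    intro W hW
    have hb : ∀ p ∈ ({b.1, b'.1} : Set (ℙ K V)), p.rep ∈ Subspace.submodule W := fun p hp => by
      rw [Subspace.mem_submodule_iff _ (rep_nonzero p), mk_rep]
      exact hW hp
    rw [← Subspace.mem_submodule_iff _ ht, ← inv_smul_smul₀ hc0 t, hc]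
    exact Submodule.smul_mem _ _ (Submodule.sub_mem _ (hb _ (by simp))
      (Submodule.smul_mem _ _ (hb _ (by simp))))
  · intro x y hx hy hxy hxB hyB hT'
    rw [hφ, hφ, mk_eq_mk_iff']
    obtain ⟨c, hc⟩ := (mk_eq_mk_iff' K _ _ _ _).1 hT'
    have h := (hker (x + y)).2 ⟨c, hc⟩
    rw [map_add] at h
    exact ⟨-1, by rw [neg_one_smul]; exact (eq_neg_of_add_eq_zero_left h).symm⟩

/-- If some point outside a blocking set of a finite projective plane lies on no secant, then the
blocking set is closed under joining points, i.e. it is a projective subspace. -/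
lemma IsBlocking.exists_subspace [Finite K] (hV : Module.finrank K V = 3) {B : Set (ℙ K V)}
    (hB : IsBlocking B) {P : ℙ K V} (hP : P ∉ B)
    (hsec : ∀ R ∈ B, ∀ S ∈ B, R ≠ S → P ∉ Subspace.span {R, S}) :
    ∃ W : Projectivization.Subspace K V, (W : Set (ℙ K V)) = B := by
  obtain ⟨φ, hφs, hφi, -⟩ := hB.exists_surjective_projection hV hP
  have hφ : Function.Bijective φ := ⟨fun b b' h => by
    by_contra hn
    exact hsec _ b.2 _ b'.2 (fun h' => hn (Subtype.ext h')) (hφi b b' h hn), hφs⟩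
  have : Finite (ℙ K (Fin 2 → K)) := Quotient.finite _
  refine ⟨⟨B, fun x y hx hy hxy hxB hyB => ?_⟩, rfl⟩
  by_contra hT
  obtain ⟨χ, hχs, -, hχ⟩ := hB.exists_surjective_projection hV hT
  -- Through the bijection φ, χ becomes a surjective self-map of a finite projective line.
  have hχi : Function.Injective χ := by
    have h := (Finite.injective_iff_surjective (f := χ ∘ (Equiv.ofBijective φ hφ).symm)).2
      (hχs.comp (Equiv.surjective _))
    exact (Function.Injective.of_comp_iff' χ (Equiv.bijective _)).1 h
  have hxy' := congrArg Subtype.val (hχi (hχ x y hx hy hxy hxB hyB rfl))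
  obtain ⟨a, ha⟩ := (mk_eq_mk_iff' K _ _ hx hy).1 hxy'
  apply hT
  convert hyB using 1
  rw [mk_eq_mk_iff']
  exact ⟨a + 1, by rw [add_smul, one_smul, ha]⟩

lemma IsProjLine.not_isSaturating (hV : Module.finrank K V = 3) {S : Set (ℙ K V)}
    (hS : IsProjLine S) : ¬ IsSaturating 1 S := by
  obtain ⟨ℓ, hℓ, rfl⟩ := hS
  intro hsat
  have htop : Subspace.submodule ℓ ≠ ⊤ := fun h => by
    rw [h, finrank_top] at hℓ
    omega
  obtain ⟨v, -, hv⟩ := SetLike.exists_of_lt (lt_top_iff_ne_top.2 htop)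
  have hv0 : v ≠ 0 := fun h => hv (h ▸ Submodule.zero_mem _)
  obtain ⟨Q, hQ, -, hPQ⟩ := hsat (mk K v hv0)
  rw [Subspace.mem_submodule_iff _ hv0] at hv
  exact hv ((Subspace.mem_span _).1 hPQ ℓ (by rintro _ ⟨i, rfl⟩; exact hQ i))

lemma isSaturating_one_iff {S : Set (ℙ K V)} :
    IsSaturating 1 S ↔ ∀ P, ∃ R ∈ S, ∃ R' ∈ S, R ≠ R' ∧ P ∈ Subspace.span {R, R'} := by
  refine forall_congr' fun P => ⟨?_, ?_⟩
  · rintro ⟨Q, hQ, hi, hP⟩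
    have hQ' : Q = ![Q 0, Q 1] := by ext i; fin_cases i <;> rfl
    rw [hQ'] at hi hP
    rw [Matrix.range_cons_cons_empty] at hP
    exact ⟨Q 0, hQ 0, Q 1, hQ 1, (independent_pair_iff_ne _ _).1 hi, hP⟩
  · rintro ⟨R, hR, R', hR', hne, hP⟩
    refine ⟨![R, R'], fun i => ?_, (independent_pair_iff_ne _ _).2 hne, ?_⟩
    · fin_cases i
      · exact hR
      · exact hR'
    · rwa [Matrix.range_cons_cons_empty]

end BlockingSets

section LinearSets

open Projectivization

lemma mk_mem_linearSet {F K V : Type*} [Field F] [Field K] [AddCommGroup V] [Module K V]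
    [Module F V] {U : Submodule F V} {u : V} (hu : u ≠ 0) (huU : u ∈ U) :
    mk K u hu ∈ linearSet F K U :=
  ⟨u, hu, huU, rfl⟩

variable {F K V : Type*} [Field F] [Field K] [Algebra F K]
  [AddCommGroup V] [Module K V] [Module F V] [IsScalarTower F K V]

/-- Restricted to U, ψ is an F-linear map into a space of smaller F-dimension, so it kills a nonzero
vector of U. -/
lemma isBlocking_linearSet [FiniteDimensional F K] {U : Submodule F V}
    (hU : Module.finrank F K < Module.finrank F U) : IsBlocking (linearSet F K U) := by
  intro ψ
  have : FiniteDimensional F U := Module.finite_of_finrank_pos (by omega)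
  have h := LinearMap.ker_ne_bot_of_finrank_lt (f := (ψ.restrictScalars F).domRestrict U) hU
  obtain ⟨u, hu, hu0⟩ := Submodule.exists_mem_ne_zero_of_ne_bot h
  have hu0' : (u : V) ≠ 0 := fun h => hu0 (Subtype.ext h)
  exact ⟨u, hu0', hu, mk_mem_linearSet hu0' u.2⟩

/-- A `K`-subspace containing `U` has large dimension. -/
lemma finrank_le_mul_of_forall_mem [FiniteDimensional F K] [FiniteDimensional K V]
    (U : Submodule F V) (W : Submodule K V) (h : ∀ u ∈ U, u ∈ W) :
    Module.finrank F U ≤ Module.finrank F K * Module.finrank K W := by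
  have h0 : FiniteDimensional F W := Module.Finite.trans K W
  have : FiniteDimensional F (W.restrictScalars F) := h0
  rw [Module.finrank_mul_finrank F K W]
  exact Submodule.finrank_mono (t := W.restrictScalars F) h

end LinearSets

open Projectivization in
theorem mainTheorem2 {F K V : Type*} [Field F] [Finite F] [Field K] [Algebra F K]
    (hK : Module.finrank F K = 4)
    [AddCommGroup V] [Module K V] [Module F V] [IsScalarTower F K V]
    (hV : Module.finrank K V = 3)
    (U : Submodule F V) (hU : Module.finrank F U = 5) :
    IsSaturating 1 (linearSet F K U) ↔ ¬ IsProjLine (linearSet F K U) := by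
  have : FiniteDimensional F K := Module.finite_of_finrank_pos (by omega)
  have : FiniteDimensional K V := Module.finite_of_finrank_pos (by omega)
  have : Finite K := Module.finite_of_finite F
  refine ⟨fun h h' => h'.not_isSaturating hV h, fun hline => ?_⟩
  rw [isSaturating_one_iff]
  intro P
  by_contra! hsec
  have hP : P ∉ linearSet F K U := by
    intro hP
    -- A single point has F-dimension 4 < 5, so the linear set has a second point, and P lies on its
    -- join with that point.
    have hle : ¬ ∀ u ∈ U, u ∈ P.submodule := fun h => by
      have := finrank_le_mul_of_forall_mem U P.submodule h
      rw [P.finrank_submodule] at this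
      omega
    push Not at hle
    obtain ⟨u, huU, hu⟩ := hle
    have hu0 : u ≠ 0 := fun h => hu (h ▸ Submodule.zero_mem _)
    refine hsec P hP _ (mk_mem_linearSet hu0 huU) ?_ (Subspace.subset_span _ (by simp))
    rintro rfl
    exact hu (by rw [submodule_mk]; exact Submodule.mem_span_singleton_self u)
  obtain ⟨W, hW⟩ := (isBlocking_linearSet (by omega)).exists_subspace hV hP hsec
  refine hline ⟨W, ?_, hW.symm⟩
  -- 5 ≤ 4 · dim W gives dim W ≥ 2, while P outside W gives dim W < 3.
  have h1 := finrank_le_mul_of_forall_mem U (Subspace.submodule W) fun u hu h0 =>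
    hW.ge (mk_mem_linearSet h0 hu)
  have h2 : Module.finrank K (Subspace.submodule W) < Module.finrank K V := by
    refine Submodule.finrank_lt fun h => hP ?_
    rw [← hW, ← mk_rep P]
    exact (Subspace.mem_submodule_iff _ P.rep_nonzero).1 (h ▸ Submodule.mem_top)
  rw [hK, hU] at h1
  omega
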